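/- Let $m\ge 2$ be an integer. There is a constant $c(m)>0$, depending only on $m$, such that the following holds for all integers $n\ge m$. Let $A_1,\dots,A_n$ be independent random vectors, each uniformly distributed on the unit sphere $S^{m-1}\subset\mathbb{R}^m$, and let $A=[A_1\,\cdots\,A_n]^{\mathrm T}$ be the random $n\times m$ matrix with rows $A_1,\dots,A_n$ (a uniform random matrix). Then for all real $t\ge 1/\cos(\pi/4)$, $$\mathbf{P}\left[\mathscr{C}(A)\ge t\right]\;\ge\; c(m)\cdot\left(\frac{I_{m-2}\left(\arccos\frac1t\right)}{I_{m-2}(\pi)}\right)^{n-m}\cdot\frac1t .$$ Here $I_k(\rho)=\int_0^\rho \sin^k x\,dx$, and for a real $n\times m$ matrix $A$ with nonzero rows $a_1,\dots,a_n$ the condition number is $\mathscr{C}(A)=|\cos\theta(A)|^{-1}\in[1,\infty]$ (equal to $\infty$ when $\cos\theta(A)=0$), where $$\theta(A)=\sup_{x\in\mathbb{R}^m\setminus\{0\}}\ \min_{1\le i\le n}\ \arccos\frac{a_i\cdot x}{\|a_i\|\,\|x\|}.$$ -/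

import Mathlib

open MeasureTheory ProbabilityTheory
open scoped ENNReal

noncomputable section

namespace ConicCondition

/-- The `i`-th row of a real matrix, as a vector of the Euclidean space `ℝ^m`. -/
def row {n m : ℕ} (A : Matrix (Fin n) (Fin m) ℝ) (i : Fin n) : EuclideanSpace ℝ (Fin m) :=
  WithLp.toLp 2 (A i)

/-- `θ(A, x) = min_i θ_i(A, x)`, where `θ_i(A, x) ∈ [0, π]` is the angle
`arccos (a_i ⬝ x / (‖a_i‖ ‖x‖))` between the `i`-th row `a_i` of `A` and `x`. -/
def thetaAt {n m : ℕ} (A : Matrix (Fin n) (Fin m) ℝ) (x : EuclideanSpace ℝ (Fin m)) : ℝ :=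
  ⨅ i : Fin n, InnerProductGeometry.angle (row A i) x

/-- `θ(A) = sup_{x ≠ 0} θ(A, x)`. -/
def theta {n m : ℕ} (A : Matrix (Fin n) (Fin m) ℝ) : ℝ :=
  ⨆ x : {x : EuclideanSpace ℝ (Fin m) // x ≠ 0}, thetaAt A x.1

/-- The condition number `𝒞(A) = 1 / |cos θ(A)| ∈ [0, ∞]`; it is `∞` exactly when
`cos θ(A) = 0`. -/
def condNumber {n m : ℕ} (A : Matrix (Fin n) (Fin m) ℝ) : ℝ≥0∞ :=
  (ENNReal.ofReal |Real.cos (theta A)|)⁻¹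

/-- The unit sphere `S^{m-1}` of `ℝ^m`. -/
abbrev Sphere (m : ℕ) : Type := Metric.sphere (0 : EuclideanSpace ℝ (Fin m)) 1

/-- The uniform distribution on `S^{m-1}`: surface measure divided by the total surface area. -/
def sphereUniform (m : ℕ) : Measure (Sphere m) :=
  ((volume : Measure (EuclideanSpace ℝ (Fin m))).toSphere Set.univ)⁻¹ •
    (volume : Measure (EuclideanSpace ℝ (Fin m))).toSphere

/-- The random rows `A_1, …, A_n` are i.i.d. and uniformly distributed on `S^{m-1}`. -/
structure UniformRows {n m : ℕ} {Ω : Type*} [MeasurableSpace Ω] (P : Measure Ω)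
    (A : Fin n → Ω → Sphere m) : Prop where
  measurable : ∀ i, Measurable (A i)
  indep : iIndepFun A P
  law : ∀ i, P.map (A i) = sphereUniform m

/-- The random matrix `A = [A_1 … A_n]ᵀ` with rows `A_1, …, A_n`. -/
def randomMatrix {n m : ℕ} {Ω : Type*} (A : Fin n → Ω → Sphere m) (ω : Ω) :
    Matrix (Fin n) (Fin m) ℝ :=
  Matrix.of fun i j => (A i ω : EuclideanSpace ℝ (Fin m)) j

/-- `I_k(ρ) = ∫_0^ρ sin^k x dx`. -/
def sinPowIntegral (k : ℕ) (ρ : ℝ) : ℝ :=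
  ∫ x in (0 : ℝ)..ρ, Real.sin x ^ k

end ConicCondition

end

namespace ConicCondition

/-! Put `ε = 1/t`. Since `arccos ε ≤ π/2`, the ratio of sine integrals is at most `1/2`
(`sinPowIntegral_div_le_half`), so a lower bound of order `2^(-n) ε` suffices.

A family of rows in `shallowSet` has `|cos θ| ≤ ε` (`abs_cos_theta_le_of_mem_shallowSet`). The law
of the rows is invariant under all `2^n` sign changes, and some sign change makes the family shallow
as soon as its first `m` rows lie in `signedShallowSet`; a union bound therefore costs only a factor
`2^n` (`pi_signedShallowSet_le`). Among these `m` rows, `m - 1` are linearly independent with a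
positive probability depending only on `m`, and the remaining one is then within `ε` of their span
with probability at least `ε / 2` (`le_pi_signedShallowSet`, `le_sphereUniform_band`). -/

open scoped RealInnerProductSpace Pointwise

/-! ### Volume of a double cone around a hyperplane. -/

/-- A proper subspace of `ℝ^m` has a unit normal vector. -/
lemma exists_unit_orthogonal {m : ℕ} (W : Submodule ℝ (EuclideanSpace ℝ (Fin m)))
    (hW : Module.finrank ℝ W < m) :
    ∃ y : EuclideanSpace ℝ (Fin m), ‖y‖ = 1 ∧ ∀ w ∈ W, ⟪w, y⟫ = 0 := by
  have hne : Wᗮ ≠ ⊥ := by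
    intro h
    have h1 := W.finrank_add_finrank_orthogonal
    rw [h, finrank_bot, finrank_euclideanSpace_fin] at h1
    omega
  obtain ⟨z, hz, hz0⟩ := Submodule.exists_mem_ne_zero_of_ne_bot hne
  refine ⟨‖z‖⁻¹ • z, norm_smul_inv_norm (𝕜 := ℝ) hz0, fun w hw => ?_⟩
  rw [inner_smul_right, (Submodule.mem_orthogonal W z).1 hz w hw, mul_zero]

/-- In the unit ball, the set `{|⟪x, y⟫| ≤ ε ‖x‖}` has volume at least `ε / 2` times the volume of
the ball: it contains the image of `{|⟪x, y⟫| ≤ |⟪x, u⟫|}` under the contraction by `ε` along `y`,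
and the reflection that swaps `u` and `y` shows that the latter fills half of the ball. -/
lemma volume_ball_le_volume_double_cone {m : ℕ} {u y : EuclideanSpace ℝ (Fin m)}
    (hu : ‖u‖ = 1) (hy : ‖y‖ = 1) (huy : ⟪u, y⟫ = 0) {ε : ℝ} (hε : 0 < ε) (hε1 : ε ≤ 1) :
    ENNReal.ofReal (ε / 2) * volume (Metric.ball (0 : EuclideanSpace ℝ (Fin m)) 1) ≤
      volume {x : EuclideanSpace ℝ (Fin m) | x ≠ 0 ∧ ‖x‖ < 1 ∧ |⟪x, y⟫| ≤ ε * ‖x‖} := by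
  set D : Set (EuclideanSpace ℝ (Fin m)) := {x | x ≠ 0 ∧ ‖x‖ < 1 ∧ |⟪x, y⟫| ≤ |⟪x, u⟫|} with hD
  have hyy : ⟪y, y⟫ = 1 := by rw [real_inner_self_eq_norm_sq, hy]; norm_num
  have hball : volume (Metric.ball (0 : EuclideanSpace ℝ (Fin m)) 1) ≤ 2 * volume D := by
    have hm : m ≠ 0 := by
      rintro rfl
      rw [Subsingleton.elim u 0, norm_zero] at hu
      exact zero_ne_one hu
    have : Nonempty (Fin m) := ⟨⟨0, Nat.pos_of_ne_zero hm⟩⟩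
    let ρ := (ℝ ∙ (u - y))ᗮ.reflection
    have hρu : ρ u = y := Submodule.reflection_sub (hu.trans hy.symm)
    have hρρ : ∀ x, ρ (ρ x) = x := Submodule.reflection_reflection _
    have hρy : ρ y = u := by rw [← hρu, hρρ]
    have hiu : ∀ x, ⟪ρ x, u⟫ = ⟪x, y⟫ := fun x => by
      rw [← hρy, ρ.inner_map_map]
    have hiy : ∀ x, ⟪ρ x, y⟫ = ⟪x, u⟫ := fun x => by
      rw [← hρu, ρ.inner_map_map]
    have hsub : Metric.ball (0 : EuclideanSpace ℝ (Fin m)) 1 \ {0} ⊆ D ∪ ρ ⁻¹' D := by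
      rintro x ⟨hx, hx0⟩
      have hx1 : ‖x‖ < 1 := by simpa using hx
      have hx0 : x ≠ 0 := hx0
      rcases le_total |⟪x, y⟫| |⟪x, u⟫| with h | h
      · exact Or.inl ⟨hx0, hx1, h⟩
      · refine Or.inr ⟨?_, ?_, ?_⟩
        · simpa using hx0
        · rwa [ρ.norm_map]
        · rwa [hiu, hiy]
    have hpre : volume (ρ ⁻¹' D) = volume D :=
      ρ.measurePreserving.measure_preimage_emb ρ.toHomeomorph.measurableEmbedding D
    calc volume (Metric.ball (0 : EuclideanSpace ℝ (Fin m)) 1)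
        = volume (Metric.ball (0 : EuclideanSpace ℝ (Fin m)) 1 \ {0}) :=
          (measure_sdiff_null (measure_singleton _)).symm
      _ ≤ volume (D ∪ ρ ⁻¹' D) := measure_mono hsub
      _ ≤ volume D + volume (ρ ⁻¹' D) := measure_union_le _ _
      _ = 2 * volume D := by rw [hpre, two_mul]
  let T : EuclideanSpace ℝ (Fin m) →ₗ[ℝ] EuclideanSpace ℝ (Fin m) :=
    LinearMap.transvection (innerₛₗ ℝ y) ((ε - 1) • y)
  have hT : ∀ x, T x = x + ⟪y, x⟫ • ((ε - 1) • y) := fun x => rfl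
  have hdet : LinearMap.det T = ε := by
    rw [LinearMap.transvection.det]
    simp [hy]
  have hTD : T '' D ⊆ {x | x ≠ 0 ∧ ‖x‖ < 1 ∧ |⟪x, y⟫| ≤ ε * ‖x‖} := by
    rintro _ ⟨x, ⟨hx0, hx1, hx⟩, rfl⟩
    have h1 : ⟪T x, y⟫ = ε * ⟪x, y⟫ := by
      rw [hT, inner_add_left, inner_smul_left, inner_smul_left, hyy, real_inner_comm x y]
      simp; ring
    have h2 : ⟪T x, u⟫ = ⟪x, u⟫ := by
      rw [hT, inner_add_left, inner_smul_left, inner_smul_left, real_inner_comm u y, huy]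
      simp
    have hnorm : ‖T x‖ ^ 2 = ‖x‖ ^ 2 + ⟪x, y⟫ ^ 2 * (ε ^ 2 - 1) := by
      rw [hT, norm_add_sq_real, inner_smul_right, inner_smul_right, norm_smul, norm_smul, hy,
        real_inner_comm x y, mul_pow, mul_pow, Real.norm_eq_abs, Real.norm_eq_abs, sq_abs, sq_abs]
      ring
    have hle : ‖T x‖ ≤ ‖x‖ := by
      refine (sq_le_sq₀ (norm_nonneg _) (norm_nonneg _)).1 ?_
      nlinarith [mul_nonneg (sq_nonneg ⟪x, y⟫) (show (0 : ℝ) ≤ 1 - ε ^ 2 by nlinarith)]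
    refine ⟨fun h0 => hx0 ?_, hle.trans_lt hx1, ?_⟩
    · have h3 : ⟪x, y⟫ = 0 := by
        rw [h0, inner_zero_left] at h1
        exact (mul_eq_zero.1 h1.symm).resolve_left hε.ne'
      rw [h0, h3] at hnorm
      simpa using hnorm.symm
    -- `T` scales the `y`-component by `ε` and keeps the `u`-component, which is at most `‖T x‖`.
    · rw [h1, abs_mul, abs_of_pos hε]
      refine mul_le_mul_of_nonneg_left (hx.trans ?_) hε.le
      rw [← h2]
      simpa [hu] using abs_real_inner_le_norm (T x) u
  calc ENNReal.ofReal (ε / 2) * volume (Metric.ball (0 : EuclideanSpace ℝ (Fin m)) 1)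
      ≤ ENNReal.ofReal (ε / 2) * (2 * volume D) := by gcongr
    _ = ENNReal.ofReal ε * volume D := by
        have h2 : ENNReal.ofReal (ε / 2) * 2 = ENNReal.ofReal ε := by
          conv_lhs => rw [show (2 : ℝ≥0∞) = ENNReal.ofReal 2 by simp]
          rw [← ENNReal.ofReal_mul (by positivity), div_mul_cancel₀ ε two_ne_zero]
        rw [← mul_assoc, h2]
    _ = volume (T '' D) := by
        rw [Measure.addHaar_image_linearMap, hdet, abs_of_pos hε]
    _ ≤ _ := measure_mono hTD

/-! ### The uniform measure on the sphere. -/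

instance isProbabilityMeasure_sphereUniform {m : ℕ} [NeZero m] :
    IsProbabilityMeasure (sphereUniform m) where
  measure_univ := by
    rw [sphereUniform, Measure.smul_apply, smul_eq_mul]
    refine ENNReal.inv_mul_cancel ?_ (measure_ne_top _ _)
    rw [ne_eq, Measure.measure_univ_eq_zero]
    exact Measure.toSphere_ne_zero _

instance isOpenPosMeasure_sphereUniform {m : ℕ} : (sphereUniform m).IsOpenPosMeasure :=
  Measure.isOpenPosMeasure_smul _ (ENNReal.inv_ne_zero.2 (measure_ne_top _ _))

instance sigmaFinite_sphereUniform {m : ℕ} [NeZero m] : SigmaFinite (sphereUniform m) :=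
  IsFiniteMeasure.toSigmaFinite _

lemma measurePreserving_neg_sphereUniform (m : ℕ) :
    MeasurePreserving (fun b : Sphere m => -b) (sphereUniform m) (sphereUniform m) := by
  have hmeas : Measurable (fun b : Sphere m => -b) := continuous_neg.measurable
  suffices h : MeasurePreserving (fun b : Sphere m => -b)
      (volume : Measure (EuclideanSpace ℝ (Fin m))).toSphere
      (volume : Measure (EuclideanSpace ℝ (Fin m))).toSphere from h.smul_measure _
  refine ⟨hmeas, Measure.ext fun s hs => ?_⟩
  rw [Measure.map_apply hmeas hs, Measure.toSphere_apply' _ (hmeas hs),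
    Measure.toSphere_apply' _ hs]
  congr 1
  rw [← Measure.measure_neg volume (Set.Ioo (0 : ℝ) 1 • (Subtype.val '' s)), ← Set.smul_neg]
  congr 2
  ext x
  constructor
  · rintro ⟨b, hb, rfl⟩
    exact ⟨-b, hb, by simp⟩
  · rintro ⟨b, hb, hx⟩
    exact ⟨-b, by simpa using hb, by simp [hx]⟩

/-- A spherical band of half-width `ε` around a great subsphere has probability at least `ε / 2`. -/
lemma le_sphereUniform_band {m : ℕ} (hm : 2 ≤ m) {y : EuclideanSpace ℝ (Fin m)} (hy : ‖y‖ = 1)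
    {ε : ℝ} (hε : 0 < ε) (hε1 : ε ≤ 1) :
    ENNReal.ofReal (ε / 2) ≤
      sphereUniform m {b : Sphere m | |⟪(b : EuclideanSpace ℝ (Fin m)), y⟫| ≤ ε} := by
  obtain ⟨u, hu, huy⟩ := exists_unit_orthogonal (ℝ ∙ y)
    ((finrank_span_singleton (by rintro rfl; simp at hy)).trans_lt hm)
  have huy : ⟪u, y⟫ = 0 := by
    rw [real_inner_comm]; exact huy y (Submodule.mem_span_singleton_self y)
  have hvol := volume_ball_le_volume_double_cone hu hy huy hε hε1
  set s := {b : Sphere m | |⟪(b : EuclideanSpace ℝ (Fin m)), y⟫| ≤ ε} with hs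
  have hsm : MeasurableSet s := by
    refine (isClosed_le (Continuous.abs ?_) continuous_const).measurableSet
    exact continuous_subtype_val.inner continuous_const
  have hcone : {x : EuclideanSpace ℝ (Fin m) | x ≠ 0 ∧ ‖x‖ < 1 ∧ |⟪x, y⟫| ≤ ε * ‖x‖} ⊆
      Set.Ioo (0 : ℝ) 1 • (Subtype.val '' s) := by
    rintro x ⟨hx0, hx1, hx⟩
    have hpos : 0 < ‖x‖ := norm_pos_iff.2 hx0
    refine Set.mem_smul.2 ⟨‖x‖, ⟨hpos, hx1⟩, ‖x‖⁻¹ • x,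
      ⟨⟨‖x‖⁻¹ • x, by simpa using norm_smul_inv_norm (𝕜 := ℝ) hx0⟩, ?_, rfl⟩,
      smul_inv_smul₀ hpos.ne' x⟩
    change |⟪‖x‖⁻¹ • x, y⟫| ≤ ε
    rw [inner_smul_left, abs_mul]
    simp only [conj_trivial, abs_inv, abs_norm]
    rw [inv_mul_le_iff₀ hpos]
    linarith
  have : NeZero m := ⟨by omega⟩
  have h1 : ENNReal.ofReal (ε / 2) *
      (volume : Measure (EuclideanSpace ℝ (Fin m))).toSphere Set.univ ≤
      (volume : Measure (EuclideanSpace ℝ (Fin m))).toSphere s := by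
    rw [Measure.toSphere_apply' _ hsm, Measure.toSphere_apply_univ, mul_left_comm]
    gcongr
    exact hvol.trans (measure_mono hcone)
  have h0 : (volume : Measure (EuclideanSpace ℝ (Fin m))).toSphere Set.univ ≠ 0 := by
    rw [ne_eq, Measure.measure_univ_eq_zero]
    exact Measure.toSphere_ne_zero _
  rw [sphereUniform, Measure.smul_apply, smul_eq_mul, mul_comm, ← div_eq_mul_inv]
  exact (ENNReal.le_div_iff_mul_le (Or.inl h0) (Or.inl (measure_ne_top _ _))).2 h1

/-! ### Shallow families and their measurability. -/

/-- Families of unit vectors that have a convex combination of norm at most `ε` and that lie, up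
to `ε`, in a common half-space. -/
def shallowSet (n m : ℕ) (ε : ℝ) : Set (Fin n → Sphere m) :=
  {a | ∃ p : Sphere m × stdSimplex ℝ (Fin n),
    (∀ i, -ε ≤ ⟪(a i : EuclideanSpace ℝ (Fin m)), p.1⟫) ∧
      ‖∑ i, p.2.1 i • (a i : EuclideanSpace ℝ (Fin m))‖ ≤ ε}

/-- Families of unit vectors that become members of `shallowSet` after changing some signs, with a
normal vector that does not depend on the signs. -/
def signedShallowSet (n m : ℕ) (ε : ℝ) : Set (Fin n → Sphere m) :=
  {a | ∃ p : Sphere m × {w : Fin n → ℝ | ∑ i, |w i| = 1},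
    (∀ i, |⟪(a i : EuclideanSpace ℝ (Fin m)), p.1⟫| ≤ ε) ∧
      ‖∑ i, p.2.1 i • (a i : EuclideanSpace ℝ (Fin m))‖ ≤ ε}

/-- Projection along a compact factor is a closed map; this gives measurability of `shallowSet` and
`signedShallowSet` despite their existential quantifiers. -/
lemma isClosed_setOf_exists {X Y : Type*} [TopologicalSpace X] [TopologicalSpace Y]
    [CompactSpace X] {C : Set (X × Y)} (hC : IsClosed C) : IsClosed {y | ∃ x, (x, y) ∈ C} := by
  have h := isClosedMap_snd_of_compactSpace _ hC
  convert h using 1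
  ext y
  simp

lemma measurableSet_shallowSet (n m : ℕ) (ε : ℝ) : MeasurableSet (shallowSet n m ε) := by
  refine IsClosed.measurableSet (isClosed_setOf_exists (C := {q : (Sphere m ×
    stdSimplex ℝ (Fin n)) × (Fin n → Sphere m) | (∀ i, -ε ≤ ⟪(q.2 i :
    EuclideanSpace ℝ (Fin m)), q.1.1⟫) ∧
    ‖∑ i, q.1.2.1 i • (q.2 i : EuclideanSpace ℝ (Fin m))‖ ≤ ε})
    (IsClosed.and ?_ ?_))
  · rw [Set.ofPred_forall]
    refine isClosed_iInter fun i => isClosed_le continuous_const ?_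
    exact Continuous.inner (by fun_prop) (by fun_prop)
  · refine isClosed_le (Continuous.norm (continuous_finsetSum _ fun i _ => ?_)) continuous_const
    exact ((continuous_apply i).comp (continuous_subtype_val.comp
      (continuous_snd.comp continuous_fst))).smul
        (continuous_subtype_val.comp ((continuous_apply i).comp continuous_snd))

lemma isCompact_sum_abs_eq_one (n : ℕ) : IsCompact {w : Fin n → ℝ | ∑ i, |w i| = 1} := by
  refine (isCompact_Icc (a := (-1 : Fin n → ℝ)) (b := 1)).of_isClosed_subset
    (isClosed_eq (by fun_prop) continuous_const) fun w hw => ?_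
  have h : ∀ i, |w i| ≤ 1 := fun i =>
    (Finset.single_le_sum (f := fun i => |w i|) (fun j _ => abs_nonneg _)
      (Finset.mem_univ i)).trans_eq hw
  exact ⟨fun i => (abs_le.1 (h i)).1, fun i => (abs_le.1 (h i)).2⟩

lemma measurableSet_signedShallowSet (n m : ℕ) (ε : ℝ) :
    MeasurableSet (signedShallowSet n m ε) := by
  have : CompactSpace {w : Fin n → ℝ | ∑ i, |w i| = 1} :=
    isCompact_iff_compactSpace.1 (isCompact_sum_abs_eq_one n)
  refine IsClosed.measurableSet (isClosed_setOf_exists (C := {q : (Sphere m ×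
    {w : Fin n → ℝ | ∑ i, |w i| = 1}) × (Fin n → Sphere m) | (∀ i, |⟪(q.2 i :
    EuclideanSpace ℝ (Fin m)), q.1.1⟫| ≤ ε) ∧
    ‖∑ i, q.1.2.1 i • (q.2 i : EuclideanSpace ℝ (Fin m))‖ ≤ ε}) (IsClosed.and ?_ ?_))
  · rw [Set.ofPred_forall]
    refine isClosed_iInter fun i => isClosed_le (Continuous.abs ?_) continuous_const
    exact Continuous.inner (by fun_prop) (by fun_prop)
  · refine isClosed_le (Continuous.norm (continuous_finsetSum _ fun i _ => ?_)) continuous_const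
    exact ((continuous_apply i).comp (continuous_subtype_val.comp
      (continuous_snd.comp continuous_fst))).smul
        (continuous_subtype_val.comp ((continuous_apply i).comp continuous_snd))

/-! ### The square case: `k + 1` rows in `ℝ^{k+1}`. -/

/-- `k` independent vectors of `ℝ^{k+1}`, together with a vector that is within `ε` of their span,
form a member of `signedShallowSet`. -/
lemma cons_mem_signedShallowSet {k : ℕ} {ε : ℝ} (hε : 0 < ε) {a : Fin k → Sphere (k + 1)}
    (ha : LinearIndependent ℝ fun i => (a i : EuclideanSpace ℝ (Fin (k + 1))))
    {y : EuclideanSpace ℝ (Fin (k + 1))} (hy : ‖y‖ = 1)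
    (hay : ∀ i, ⟪(a i : EuclideanSpace ℝ (Fin (k + 1))), y⟫ = 0) {b : Sphere (k + 1)}
    (hb : |⟪(b : EuclideanSpace ℝ (Fin (k + 1))), y⟫| ≤ ε) :
    (Fin.cons b a : Fin (k + 1) → Sphere (k + 1)) ∈ signedShallowSet (k + 1) (k + 1) ε := by
  set v : Fin k → EuclideanSpace ℝ (Fin (k + 1)) := fun i => a i with hv
  set W := Submodule.span ℝ (Set.range v) with hW
  have hyW : y ∈ Wᗮ := by
    rw [Submodule.mem_orthogonal]
    intro w hw
    induction hw using Submodule.span_induction with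
    | mem x hx => obtain ⟨i, rfl⟩ := hx; exact hay i
    | zero => exact inner_zero_left _
    | add x z _ _ hx hz => rw [inner_add_left, hx, hz, add_zero]
    | smul c x _ hx => rw [inner_smul_left, hx, mul_zero]
  have hdim : Module.finrank ℝ Wᗮ = 1 := by
    have h1 := W.finrank_add_finrank_orthogonal
    rw [finrank_euclideanSpace_fin, hW, finrank_span_eq_card ha, Fintype.card_fin] at h1
    rw [hW]
    omega
  have hyy : ⟪y, y⟫ = 1 := by rw [real_inner_self_eq_norm_sq, hy]; norm_num
  have hspan : Wᗮ = ℝ ∙ y := by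
    symm
    apply Submodule.eq_of_le_of_finrank_eq
    · rwa [Submodule.span_singleton_le_iff_mem]
    · rw [hdim, finrank_span_singleton (by rintro rfl; simp at hy)]
  obtain ⟨w, hw, z, hz, hwz⟩ := W.exists_add_mem_mem_orthogonal (b : EuclideanSpace ℝ (Fin (k + 1)))
  rw [hspan, Submodule.mem_span_singleton] at hz
  obtain ⟨s, rfl⟩ := hz
  have hby : ⟪(b : EuclideanSpace ℝ (Fin (k + 1))), y⟫ = s := by
    rw [hwz, inner_add_left, (Submodule.mem_orthogonal W y).1 hyW w hw, inner_smul_left, hyy]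
    simp
  obtain ⟨c, hc⟩ := (Submodule.mem_span_range_iff_exists_fun ℝ).1 hw
  -- `b - ∑ c i • a i = s • y` with `|s| ≤ ε`. Dividing by the `ℓ¹` norm `N` of the coefficients
  -- normalises the weights, and `N ≥ 1` keeps the norm at most `ε`.
  set N := 1 + ∑ i, |c i| with hN
  have hN1 : 1 ≤ N := le_add_of_nonneg_right (Finset.sum_nonneg fun i _ => abs_nonneg _)
  have hN0 : 0 < N := by linarith
  refine ⟨⟨⟨y, by simpa using hy⟩, ⟨Fin.cons N⁻¹ fun i => -(N⁻¹ * c i), ?_⟩⟩, ?_, ?_⟩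
  · simp only [Set.mem_ofPred_eq, Fin.sum_univ_succ, Fin.cons_zero, Fin.cons_succ, abs_neg, abs_mul,
      abs_inv, abs_of_pos hN0]
    rw [← Finset.mul_sum]
    field_simp
    exact hN.symm
  · intro i
    refine Fin.cases ?_ (fun j => ?_) i
    · simpa using hb
    · simp only [Fin.cons_succ, hay j, abs_zero]
      exact hε.le
  · have hsum : ∑ i, (Fin.cons N⁻¹ (fun i => -(N⁻¹ * c i)) : Fin (k + 1) → ℝ) i •
        ((Fin.cons b a : Fin (k + 1) → Sphere (k + 1)) i : EuclideanSpace ℝ (Fin (k + 1))) =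
        N⁻¹ • s • y := by
      simp only [Fin.sum_univ_succ, Fin.cons_zero, Fin.cons_succ]
      rw [hwz, ← hc]
      simp only [hv, neg_smul, mul_smul, Finset.sum_neg_distrib, ← Finset.smul_sum, smul_add]
      abel
    change ‖∑ i, (Fin.cons N⁻¹ (fun i => -(N⁻¹ * c i)) : Fin (k + 1) → ℝ) i •
        ((Fin.cons b a : Fin (k + 1) → Sphere (k + 1)) i : EuclideanSpace ℝ (Fin (k + 1)))‖ ≤ ε
    rw [hsum, norm_smul, norm_smul, hy, mul_one, norm_inv, Real.norm_eq_abs, Real.norm_eq_abs,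
      abs_of_pos hN0, ← hby]
    exact (mul_le_of_le_one_left (abs_nonneg _) (inv_le_one_of_one_le₀ hN1)).trans hb

/-- The event that the rows are linearly independent has positive probability. -/
lemma pi_sphereUniform_linearIndependent_ne_zero (k : ℕ) :
    Measure.pi (fun _ : Fin k => sphereUniform (k + 1)) {a : Fin k → Sphere (k + 1) |
      LinearIndependent ℝ fun i => (a i : EuclideanSpace ℝ (Fin (k + 1)))} ≠ 0 := by
  refine IsOpen.measure_ne_zero _ ?_ ?_
  · exact isOpen_setOfPred_linearIndependent.preimage (by fun_prop :
      Continuous fun (a : Fin k → Sphere (k + 1)) i => (a i : EuclideanSpace ℝ (Fin (k + 1))))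
  · refine ⟨fun i => ⟨EuclideanSpace.single i.castSucc 1, by simp⟩, ?_⟩
    have h := (EuclideanSpace.basisFun (Fin (k + 1)) ℝ).orthonormal.linearIndependent.comp
      Fin.castSucc (Fin.castSucc_injective k)
    have hv : (⇑(EuclideanSpace.basisFun (Fin (k + 1)) ℝ) ∘ Fin.castSucc) =
        fun i => EuclideanSpace.single i.castSucc (1 : ℝ) := funext fun i => by simp
    rwa [hv] at h

/-- Fubini: once the last `k` rows are fixed and independent, row `0` only has to fall in the band
around their span. -/
lemma le_pi_signedShallowSet {k : ℕ} (hk : 1 ≤ k) {ε : ℝ} (hε : 0 < ε) (hε1 : ε ≤ 1) :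
    ENNReal.ofReal (ε / 2) * Measure.pi (fun _ : Fin k => sphereUniform (k + 1))
      {a | LinearIndependent ℝ fun i => (a i : EuclideanSpace ℝ (Fin (k + 1)))} ≤
    Measure.pi (fun _ : Fin (k + 1) => sphereUniform (k + 1))
      (signedShallowSet (k + 1) (k + 1) ε) := by
  set L : Set (Fin k → Sphere (k + 1)) :=
    {a | LinearIndependent ℝ fun i => (a i : EuclideanSpace ℝ (Fin (k + 1)))} with hL
  have hLm : MeasurableSet L :=
    (isOpen_setOfPred_linearIndependent.preimage (by fun_prop : Continuous
      fun (a : Fin k → Sphere (k + 1)) i => (a i : EuclideanSpace ℝ (Fin (k + 1))))).measurableSet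
  set e := MeasurableEquiv.piFinSuccAbove (fun _ : Fin (k + 1) => Sphere (k + 1)) 0 with he
  have hmp := (measurePreserving_piFinSuccAbove (fun _ : Fin (k + 1) => sphereUniform (k + 1)) 0)
  have hS := measurableSet_signedShallowSet (k + 1) (k + 1) ε
  rw [← (hmp.symm _).measure_preimage hS.nullMeasurableSet,
    Measure.prod_apply_symm ((MeasurableEquiv.measurable _) hS), ← setLIntegral_const]
  refine (setLIntegral_mono' hLm fun a ha => ?_).trans (setLIntegral_le_lintegral L _)
  obtain ⟨y, hy, hay⟩ := exists_unit_orthogonal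
    (Submodule.span ℝ (Set.range fun i => (a i : EuclideanSpace ℝ (Fin (k + 1)))))
    ((finrank_range_le_card _).trans_lt (by simp))
  refine (le_sphereUniform_band (by omega) hy hε hε1).trans (measure_mono fun b hb => ?_)
  have h := cons_mem_signedShallowSet hε ha hy
    (fun i => hay _ (Submodule.subset_span (Set.mem_range_self i))) hb
  simpa [Fin.consEquiv] using h

/-! ### From shallow families to the condition number. -/

lemma row_randomMatrix {n m : ℕ} {Ω : Type*} (A : Fin n → Ω → Sphere m) (ω : Ω) (i : Fin n) :
    row (randomMatrix A ω) i = (A i ω : EuclideanSpace ℝ (Fin m)) := rfl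

lemma thetaAt_le_pi {n m : ℕ} (hn : 0 < n) (A : Matrix (Fin n) (Fin m) ℝ)
    (x : EuclideanSpace ℝ (Fin m)) : thetaAt A x ≤ Real.pi :=
  (ciInf_le (Set.finite_range _).bddBelow (⟨0, hn⟩ : Fin n)).trans
    (InnerProductGeometry.angle_le_pi _ _)

/-- If the rows of a matrix are unit vectors forming a member of `shallowSet`, then `θ` is close
to `π / 2`. -/
lemma abs_cos_theta_le_of_mem_shallowSet {n m : ℕ} (hn : 0 < n) {ε : ℝ}
    (A : Matrix (Fin n) (Fin m) ℝ) {a : Fin n → Sphere m}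
    (hrow : ∀ i, row A i = (a i : EuclideanSpace ℝ (Fin m))) (ha : a ∈ shallowSet n m ε) :
    |Real.cos (theta A)| ≤ ε := by
  have : Nonempty (Fin n) := ⟨⟨0, hn⟩⟩
  obtain ⟨⟨y, w⟩, hy, hw⟩ := ha
  have hε : 0 ≤ ε := (norm_nonneg _).trans hw
  rcases le_total 1 ε with h1 | h1
  · exact (Real.abs_cos_le_one _).trans h1
  have hai : ∀ i, ‖row A i‖ = 1 := fun i => by rw [hrow]; simp
  -- Without boundedness the real supremum would take its default value `0`.
  have hbdd : BddAbove (Set.range fun x : {x : EuclideanSpace ℝ (Fin m) // x ≠ 0} =>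
      thetaAt A x.1) := ⟨Real.pi, by rintro _ ⟨x, rfl⟩; exact thetaAt_le_pi hn A x.1⟩
  have hy1 : ‖(y : EuclideanSpace ℝ (Fin m))‖ = 1 := by simp
  have hy0 : -(y : EuclideanSpace ℝ (Fin m)) ≠ 0 := by
    rw [ne_eq, neg_eq_zero, ← norm_eq_zero, hy1]; exact one_ne_zero
  -- Test direction `-y`: its inner product with every row is at most `ε`.
  have hlow : Real.arccos ε ≤ theta A := by
    refine le_trans ?_ (le_ciSup hbdd ⟨_, hy0⟩)
    refine le_ciInf fun i => Real.arccos_le_arccos ?_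
    rw [hai, norm_neg, hy1, inner_neg_right, hrow]
    have := hy i
    simp only at this ⊢
    linarith
  have : Nonempty {x : EuclideanSpace ℝ (Fin m) // x ≠ 0} := ⟨⟨_, hy0⟩⟩
  -- If all rows had inner product below `-ε ‖x‖` with `x`, so would their convex combination,
  -- contradicting Cauchy–Schwarz.
  have hup : theta A ≤ Real.arccos (-ε) := by
    refine ciSup_le fun ⟨x, hx⟩ => ?_
    have hxp : 0 < ‖x‖ := norm_pos_iff.2 hx
    obtain ⟨i, hi⟩ : ∃ i, -ε * ‖x‖ ≤ ⟪(a i : EuclideanSpace ℝ (Fin m)), x⟫ := by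
      by_contra! hcon
      have h2 : ⟪∑ i, w.1 i • (a i : EuclideanSpace ℝ (Fin m)), x⟫ < -ε * ‖x‖ := by
        rw [sum_inner]
        have h3 : -ε * ‖x‖ = ∑ i, w.1 i * (-ε * ‖x‖) := by
          rw [← Finset.sum_mul, w.2.2, one_mul]
        rw [h3]
        simp only [inner_smul_left, conj_trivial]
        obtain ⟨j, hj⟩ : ∃ j, 0 < w.1 j := by
          by_contra! hneg
          have := Finset.sum_nonpos (fun i (_ : i ∈ Finset.univ) => hneg i)
          rw [w.2.2] at this
          linarith
        exact Finset.sum_lt_sum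
          (fun i _ => mul_le_mul_of_nonneg_left (hcon i).le (w.2.1 i))
          ⟨j, Finset.mem_univ j, mul_lt_mul_of_pos_left (hcon j) hj⟩
      have h4 := (abs_le.1 (abs_real_inner_le_norm
        (∑ i, w.1 i • (a i : EuclideanSpace ℝ (Fin m))) x)).1
      have h5 := mul_le_mul_of_nonneg_right hw hxp.le
      simp only at h5
      linarith
    refine (ciInf_le (Set.finite_range _).bddBelow i).trans (Real.arccos_le_arccos ?_)
    rw [hai, one_mul, le_div_iff₀ hxp, hrow]
    exact hi
  have h0 : 0 ≤ theta A := (Real.arccos_nonneg _).trans hlow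
  have hpi : theta A ≤ Real.pi := hup.trans (Real.arccos_le_pi _)
  rw [abs_le]
  constructor
  · have := Real.cos_le_cos_of_nonneg_of_le_pi h0 (Real.arccos_le_pi _) hup
    rwa [Real.cos_arccos (by linarith) (by linarith)] at this
  · have := Real.cos_le_cos_of_nonneg_of_le_pi (Real.arccos_nonneg _) hpi hlow
    rwa [Real.cos_arccos (by linarith) (by linarith)] at this

lemma le_condNumber_of_mem_shallowSet {n m : ℕ} (hn : 0 < n) {t : ℝ} (ht : 0 < t)
    (A : Matrix (Fin n) (Fin m) ℝ) {a : Fin n → Sphere m}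
    (hrow : ∀ i, row A i = (a i : EuclideanSpace ℝ (Fin m))) (ha : a ∈ shallowSet n m (1 / t)) :
    ENNReal.ofReal t ≤ condNumber A := by
  have h := abs_cos_theta_le_of_mem_shallowSet hn A hrow ha
  rw [condNumber, ENNReal.le_inv_iff_le_inv, ← ENNReal.ofReal_inv_of_pos ht]
  exact ENNReal.ofReal_le_ofReal (by rwa [one_div] at h)

/-! ### Sign changes. -/

/-- Changing the signs of the vectors of a family. -/
noncomputable def flipSigns {n m : ℕ} (σ : Fin n → Bool) (a : Fin n → Sphere m) : Fin n → Sphere m :=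
  fun i => if σ i then a i else -a i

lemma measurePreserving_flipSigns {n m : ℕ} [NeZero m] (σ : Fin n → Bool) :
    MeasurePreserving (flipSigns σ) (Measure.pi fun _ : Fin n => sphereUniform m)
      (Measure.pi fun _ : Fin n => sphereUniform m) := by
  refine measurePreserving_pi (f := fun i (b : Sphere m) => if σ i then b else -b) _ _ fun i => ?_
  cases σ i
  · simpa using measurePreserving_neg_sphereUniform m
  · simpa [Function.id_def] using MeasurePreserving.id (sphereUniform m)

/-- A family whose first vectors form a member of `signedShallowSet` can be turned into a member of
`shallowSet` by changing signs. -/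
lemma exists_flipSigns_mem_shallowSet {n k m : ℕ} (hkn : k ≤ n) {ε : ℝ} (hε : 0 ≤ ε)
    {a : Fin n → Sphere m}
    (ha : (fun i => a (Fin.castLE hkn i)) ∈ signedShallowSet k m ε) :
    ∃ σ, flipSigns σ a ∈ shallowSet n m ε := by
  obtain ⟨⟨y, w⟩, hy, hw⟩ := ha
  simp only at hy hw
  let w' : Fin n → ℝ := fun i => if h : (i : ℕ) < k then w.1 ⟨i, h⟩ else 0
  -- The first `k` rows absorb the signs of their weights, which the two-sided bound on them
  -- permits. The other rows have weight `0` and are turned to the side of `y`.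
  let σ : Fin n → Bool := fun i =>
    if (i : ℕ) < k then decide (0 ≤ w' i)
    else decide (0 ≤ ⟪(a i : EuclideanSpace ℝ (Fin m)), (y : EuclideanSpace ℝ (Fin m))⟫)
  have hsum : ∀ {M : Type} [AddCommMonoid M] (f : Fin n → M), (∀ i : Fin n, ¬ (i : ℕ) < k → f i = 0) →
      ∑ i, f i = ∑ i, f (Fin.castLE hkn i) := by
    intro M _ f hf
    symm
    refine Finset.sum_of_injOn (Fin.castLE hkn) (Fin.castLE_injective hkn).injOn (by simp) ?_
      (fun _ _ => rfl)
    intro i _ hi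
    refine hf i fun hik => hi ?_
    exact ⟨⟨i, hik⟩, by simp, rfl⟩
  have hw' : ∀ i, w' (Fin.castLE hkn i) = w.1 i := fun i => by simp [w']
  have hw0 : ∀ i : Fin n, ¬ (i : ℕ) < k → w' i = 0 := fun i hi => by simp [w', hi]
  refine ⟨σ, ⟨y, ⟨fun i => |w' i|, fun i => abs_nonneg _, ?_⟩⟩, fun i => ?_, ?_⟩
  · rw [hsum _ fun i hi => by rw [hw0 i hi, abs_zero]]
    simp only [hw']
    exact w.2
  · simp only [flipSigns]
    by_cases hi : (i : ℕ) < k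
    · have h := abs_le.1 (hy ⟨i, hi⟩)
      have hii : Fin.castLE hkn ⟨i, hi⟩ = i := rfl
      rw [hii] at h
      split_ifs
      · exact h.1
      · rw [coe_neg_sphere, inner_neg_left]; linarith [h.2]
    · simp only [σ, hi, if_false, decide_eq_true_eq]
      split_ifs with h
      · linarith
      · rw [coe_neg_sphere, inner_neg_left]; linarith [not_le.1 h]
  · have hterm : ∀ i, |w' i| • (flipSigns σ a i : EuclideanSpace ℝ (Fin m)) =
        w' i • (a i : EuclideanSpace ℝ (Fin m)) := by
      intro i
      by_cases hi : (i : ℕ) < k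
      · simp only [flipSigns, σ, hi, if_true, decide_eq_true_eq]
        split_ifs with h
        · rw [abs_of_nonneg h]
        · rw [coe_neg_sphere, abs_of_neg (not_le.1 h), neg_smul_neg]
      · rw [hw0 i hi]; simp
    simp only [hterm]
    rw [hsum _ fun i hi => by rw [hw0 i hi, zero_smul]]
    simpa only [hw'] using hw

lemma pi_signedShallowSet_le {n k m : ℕ} [NeZero m] (hkn : k ≤ n) {ε : ℝ} (hε : 0 ≤ ε) :
    Measure.pi (fun _ : Fin k => sphereUniform m) (signedShallowSet k m ε) ≤
      2 ^ n * Measure.pi (fun _ : Fin n => sphereUniform m) (shallowSet n m ε) := by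
  have hind : iIndepFun (fun (i : Fin n) (a : Fin n → Sphere m) => a i)
      (Measure.pi fun _ : Fin n => sphereUniform m) :=
    iIndepFun_pi (X := fun _ b => b) fun _ => aemeasurable_id
  have hlaw : ∀ i, (Measure.pi fun _ : Fin n => sphereUniform m).map (fun a => a i) =
      sphereUniform m := fun i => (measurePreserving_eval _ i).map_eq
  have hres : (Measure.pi fun _ : Fin n => sphereUniform m).map
      (fun (a : Fin n → Sphere m) (i : Fin k) => a (Fin.castLE hkn i)) =
      Measure.pi fun _ : Fin k => sphereUniform m := by
    rw [(hind.precomp (Fin.castLE_injective hkn)).map_fun_eq_pi_map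
      fun i => (measurable_pi_apply _).aemeasurable]
    simp only [hlaw]
  have hmeas := measurableSet_shallowSet n m ε
  rw [← hres, Measure.map_apply (by fun_prop) (measurableSet_signedShallowSet k m ε)]
  calc _ ≤ Measure.pi (fun _ : Fin n => sphereUniform m)
        (⋃ σ, flipSigns σ ⁻¹' shallowSet n m ε) := measure_mono fun a ha =>
          Set.mem_iUnion.2 (exists_flipSigns_mem_shallowSet hkn hε ha)
    _ ≤ ∑ σ, Measure.pi (fun _ : Fin n => sphereUniform m) (flipSigns σ ⁻¹' shallowSet n m ε) :=
        measure_iUnion_fintype_le _ _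
    _ = ∑ _σ : Fin n → Bool, Measure.pi (fun _ : Fin n => sphereUniform m) (shallowSet n m ε) := by
        simp only [(measurePreserving_flipSigns _).measure_preimage hmeas.nullMeasurableSet]
    _ = 2 ^ n * _ := by simp

/-! ### Sine integrals. -/

lemma sinPowIntegral_nonneg (k : ℕ) {ρ : ℝ} (h0 : 0 ≤ ρ) (hρ : ρ ≤ Real.pi) :
    0 ≤ sinPowIntegral k ρ :=
  intervalIntegral.integral_nonneg h0 fun _ hx =>
    pow_nonneg (Real.sin_nonneg_of_nonneg_of_le_pi hx.1 (hx.2.trans hρ)) k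

/-- By the symmetry `x ↦ π - x`, the integral over `[ρ, π]` equals that over `[0, π - ρ]`, which
contains `[0, ρ]`. -/
lemma sinPowIntegral_div_le_half (k : ℕ) {ρ : ℝ} (h0 : 0 ≤ ρ) (hρ : ρ ≤ Real.pi / 2) :
    sinPowIntegral k ρ / sinPowIntegral k Real.pi ≤ 1 / 2 := by
  have hint : ∀ a b : ℝ, IntervalIntegrable (fun x => Real.sin x ^ k) volume a b := fun a b =>
    (by fun_prop : Continuous fun x => Real.sin x ^ k).intervalIntegrable a b
  have hpi : 0 < sinPowIntegral k Real.pi := integral_sin_pow_pos k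
  have hsymm : ∫ x in ρ..Real.pi, Real.sin x ^ k = ∫ x in (0 : ℝ)..(Real.pi - ρ), Real.sin x ^ k := by
    have h := intervalIntegral.integral_comp_sub_left (fun x => Real.sin x ^ k) Real.pi
      (a := 0) (b := Real.pi - ρ)
    simp only [Real.sin_pi_sub, sub_zero, sub_sub_cancel] at h
    exact h.symm
  have hmid : 0 ≤ ∫ x in ρ..(Real.pi - ρ), Real.sin x ^ k :=
    intervalIntegral.integral_nonneg (by linarith) fun x hx =>
      pow_nonneg (Real.sin_nonneg_of_nonneg_of_le_pi (by linarith [hx.1]) (by linarith [hx.2])) k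
  have h1 := intervalIntegral.integral_add_adjacent_intervals (hint 0 ρ) (hint ρ Real.pi)
  have h2 := intervalIntegral.integral_add_adjacent_intervals (hint 0 ρ) (hint ρ (Real.pi - ρ))
  rw [div_le_iff₀ hpi]
  unfold sinPowIntegral
  linarith

end ConicCondition

theorem mainTheorem2 (m : ℕ) (hm : 2 ≤ m) :
    ∃ c : ℝ, 0 < c ∧
      ∀ (n : ℕ), m ≤ n →
      ∀ (Ω : Type*) [MeasurableSpace Ω] (P : Measure Ω) [IsProbabilityMeasure P]
        (A : Fin n → Ω → ConicCondition.Sphere m), ConicCondition.UniformRows P A →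
      ∀ t : ℝ, 1 / Real.cos (Real.pi / 4) ≤ t →
        ENNReal.ofReal
            (c * (ConicCondition.sinPowIntegral (m - 2) (Real.arccos (1 / t)) /
                  ConicCondition.sinPowIntegral (m - 2) Real.pi) ^ (n - m) * (1 / t)) ≤
          P {ω | ENNReal.ofReal t ≤
            ConicCondition.condNumber (ConicCondition.randomMatrix A ω)} := by
  obtain ⟨k, rfl⟩ : ∃ k, m = k + 1 := ⟨m - 1, by omega⟩
  set p := Measure.pi (fun _ : Fin k => ConicCondition.sphereUniform (k + 1))
    {a | LinearIndependent ℝ fun i => (a i : EuclideanSpace ℝ (Fin (k + 1)))} with hp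
  have hp0 : 0 < p.toReal := ENNReal.toReal_pos
    (ConicCondition.pi_sphereUniform_linearIndependent_ne_zero k) (measure_ne_top _ _)
  -- `p / 2` comes from the square case. The cost `2^(-n)` of the signs splits as `2^(-m)`, kept in
  -- the constant, times `2^(-(n-m))`, which dominates the power of the ratio.
  refine ⟨p.toReal / 2 * (1 / 2) ^ (k + 1), by positivity, ?_⟩
  intro n hn Ω _ P _ A hA t ht
  have ht1 : 1 ≤ t := by
    refine le_trans ?_ ht
    rw [le_div_iff₀ (Real.cos_pos_of_mem_Ioo ⟨by linarith [Real.pi_pos], by linarith [Real.pi_pos]⟩),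
      one_mul]
    exact Real.cos_le_one _
  have ht0 : 0 < t := by linarith
  have hε : 0 < 1 / t := by positivity
  have hε1 : 1 / t ≤ 1 := (div_le_one ht0).2 ht1
  have hlaw : P.map (fun ω i => A i ω) = Measure.pi fun _ : Fin n => ConicCondition.sphereUniform (k + 1) := by
    rw [hA.indep.map_fun_eq_pi_map fun i => (hA.measurable i).aemeasurable]
    simp only [hA.law]
  have hmain : ENNReal.ofReal (1 / t / 2) * p ≤
      2 ^ n * P {ω | ENNReal.ofReal t ≤ ConicCondition.condNumber (ConicCondition.randomMatrix A ω)} := by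
    refine (ConicCondition.le_pi_signedShallowSet (by omega) hε hε1).trans
      ((ConicCondition.pi_signedShallowSet_le hn hε.le).trans ?_)
    rw [← hlaw, Measure.map_apply (measurable_pi_lambda _ hA.measurable)
      (ConicCondition.measurableSet_shallowSet _ _ _)]
    gcongr
    intro ω hω
    exact ConicCondition.le_condNumber_of_mem_shallowSet (by omega) ht0 _ (ConicCondition.row_randomMatrix A ω) hω
  have hq := ConicCondition.sinPowIntegral_div_le_half (k + 1 - 2) (Real.arccos_nonneg (1 / t))
    (Real.arccos_le_pi_div_two.2 hε.le)
  have hq0 : 0 ≤ ConicCondition.sinPowIntegral (k + 1 - 2) (Real.arccos (1 / t)) /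
      ConicCondition.sinPowIntegral (k + 1 - 2) Real.pi :=
    div_nonneg (ConicCondition.sinPowIntegral_nonneg _ (Real.arccos_nonneg _) (Real.arccos_le_pi _))
      (ConicCondition.sinPowIntegral_nonneg _ Real.pi_pos.le le_rfl)
  have hreal : p.toReal / 2 * (1 / 2) ^ (k + 1) *
      (ConicCondition.sinPowIntegral (k + 1 - 2) (Real.arccos (1 / t)) /
        ConicCondition.sinPowIntegral (k + 1 - 2) Real.pi) ^ (n - (k + 1)) * (1 / t) ≤
      (1 / t / 2 * p.toReal) / 2 ^ n := by
    calc _ ≤ p.toReal / 2 * (1 / 2) ^ (k + 1) * (1 / 2) ^ (n - (k + 1)) * (1 / t) := by gcongr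
      _ = p.toReal / 2 * (1 / 2) ^ n * (1 / t) := by
        rw [mul_assoc (p.toReal / 2), ← pow_add, Nat.add_sub_cancel' hn]
      _ = _ := by rw [one_div_pow]; ring
  refine (ENNReal.ofReal_le_ofReal hreal).trans ?_
  rw [ENNReal.ofReal_div_of_pos (by positivity), ENNReal.ofReal_mul (by positivity),
    ENNReal.ofReal_toReal (measure_ne_top _ _), ENNReal.ofReal_pow zero_le_two,
    ENNReal.ofReal_ofNat]
  exact ENNReal.div_le_of_le_mul' hmain
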